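/- **Setting.** Spaces $C(D,\mathbb R)$, $D\subset\mathbb Z\times\mathbb R$, carry the compact-open topology and its Borel $\sigma$-algebra. Let $R=\{k,\dots,\ell\}\times[a,b]$ with $k\le \ell$ integers and $a<b$ reals, and write $z(t)=(z_k(t),\dots,z_\ell(t))$ for $z\in C(R,\mathbb R)$. * *Shifted Brownian motions.* For $x\in\mathbb R^{\{k,\dots,\ell\}}$ and a continuous $\eta:R\to\mathbb R$ with $\eta_j(a)=0$ for all $j$, let $\gamma_{x,\eta}$ be the law on $C(R,\mathbb R)$ of $(B_j(t)+x_j+\eta_j(t))_{j,t}$, where $B_k,\dots,B_\ell$ are independent standard Brownian motions on $[a,b]$ with $B_j(a)=0$. * *Shifted Brownian bridges.* For $x,y\in\mathbb R^{\{k,\dots,\ell\}}$ and a continuous $\eta:R\to\mathbb R$ with $\eta_j(a)=\eta_j(b)=0$ for all $j$, let $\breve\gamma_{x,y,\eta}$ be the law on $C(R,\mathbb R)$ of $\bigl(\breve B_j(t)+\frac{(b-t)x_j+(t-a)y_j}{b-a}+\eta_j(t)\bigr)_{j,t}$, where $\breve B_k,\dots,\breve B_\ell$ are independent Brownian bridges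 on $[a,b]$ with $\breve B_j(a)=\breve B_j(b)=0$. * *Convex Hamiltonians.* Let $\mathsf H^R$ be the set of functionals $$\mathbf H(z)=\sum_{i=1}^m f_i(z(t_i))+\int_a^b F(t,z(t))\,dt,\qquad z\in C(R,\mathbb R),$$ with $m\ge 0$, $t_i\in[a,b]$, $f_i:\mathbb R^{\{k,\dots,\ell\}}\to\mathbb R$ convex, and $F:[a,b]\times\mathbb R^{\{k,\dots,\ell\}}\to\mathbb R$ continuous with $F(t,\cdot)$ convex for every $t$. * Let $\mathring{\mathfrak M}$ be the collection, over all such $R$, of the probability measures on $C(R,\mathbb R)$ proportional to $e^{-\mathbf H}\gamma_{x,\eta}$ or to $e^{-\mathbf H}\breve\gamma_{x,y,\eta}$, with $\mathbf H\in\mathsf H^R$ and $x,y,\eta$ as above. * *Local weak convergence.* Borel probability measures $\mu_i$ on $C(\Lambda_i\times I_i,\mathbb R)$, where $\Lambda_i\subset\mathbb Z$ and $I_i\subset\mathbb R$ are (possibly infinite) intervals, converge locally weakly to a Borel probability measure $\mu_\infty$ on $C(\Lambda_\infty\times I_\infty,\mathbb R)$ if $\Lambda_i\times I_i\subset\Lambda_\infty\times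 I_\infty$ for all $i$, and every compact $K\subset\Lambda_\infty\times I_\infty$ satisfies $K\subset\Lambda_i\times I_i$ for all large $i$ and the law of the restriction to $K$ under $\mu_i$ converges weakly on $C(K,\mathbb R)$ to that under $\mu_\infty$. * *The class $\mathbf{LC}$.* A random continuous function $\mathcal L=\{\mathcal L(j,t):j\in\Lambda,\ t\in I\}$, with $\Lambda\subset\mathbb Z$ and $I\subset\mathbb R$ (possibly infinite) intervals, is in the class $\mathbf{LC}$ if its law on $C(\Lambda\times I,\mathbb R)$ is the local weak limit of a sequence in $\mathring{\mathfrak M}$. * A Borel probability measure $\mu$ on $\mathbb R^n$ is *log-concave* if $\mu(\theta A+(1-\theta)B)\ge\mu(A)^\theta\mu(B)^{1-\theta}$ for all Borel sets $A,B\subset\mathbb R^n$ and all $\theta\in(0,1)$ (point masses and other degenerate measures are allowed; if the Minkowski combination is not Borel, its outer measure is meant). **Corollary.** If $\mathcal L$ is in the class $\mathbf{LC}$, then every finite-dimensional marginal distribution of $\mathcal L$ is log-concave: for all $n\ge0$ and all $(j_1,t_1),\dots,(j_n,t_n)\in\Lambda\times I$, the law of $(\mathcal L(j_1,t_1),\dots,\mathcal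 L(j_n,t_n))$ on $\mathbb R^n$ is log-concave. -/

import Mathlib

open MeasureTheory ProbabilityTheory Filter Topology
open scoped NNReal ENNReal Pointwise

noncomputable section

namespace LineEnsemble

/-- Spaces of continuous real functions carry the compact-open topology (Mathlib's instance) and
its Borel sigma-algebra. -/
instance instMeasurableSpaceContinuousMap {X : Type*} [TopologicalSpace X] :
    MeasurableSpace C(X, ℝ) := borel _

instance instBorelSpaceContinuousMap {X : Type*} [TopologicalSpace X] :
    BorelSpace C(X, ℝ) := ⟨rfl⟩

/-! ### Log-concave measures -/

/-- A Borel measure `μ` on `ℝⁿ` is log-concave if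
`μ (θ A + (1 - θ) B) ≥ μ(A) ^ θ * μ(B) ^ (1 - θ)` for all Borel sets `A`, `B` and `0 < θ < 1`.
Degenerate measures, such as point masses, are covered. -/
def IsLogConcave {n : ℕ} (μ : Measure (Fin n → ℝ)) : Prop :=
  ∀ A B : Set (Fin n → ℝ), MeasurableSet A → MeasurableSet B →
    ∀ θ : ℝ, 0 < θ → θ < 1 →
      μ A ^ θ * μ B ^ (1 - θ) ≤ μ (θ • A + (1 - θ) • B)

/-! ### Boxes -/

/-- The data of a rectangle `R = ⟦k, l⟧ × [a, b]` in `ℤ × ℝ`, with `k ≤ l` and `a < b`. -/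
structure Box where
  k : ℤ
  l : ℤ
  a : ℝ
  b : ℝ
  hkl : k ≤ l
  hab : a < b

namespace Box

/-- The integer interval `⟦k, l⟧`. -/
abbrev Layer (R : Box) : Type := ↥(Set.Icc R.k R.l)

/-- The time interval `[a, b]`. -/
abbrev Time (R : Box) : Type := ↥(Set.Icc R.a R.b)

/-- The rectangle `⟦k, l⟧ × [a, b]` as a subset of `ℤ × ℝ`. -/
def region (R : Box) : Set (ℤ × ℝ) := Set.Icc R.k R.l ×ˢ Set.Icc R.a R.b

/-- The point `(j, t)` of the rectangle. -/
def pt (R : Box) (j : R.Layer) (t : R.Time) : ↥R.region :=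
  ⟨((j : ℤ), (t : ℝ)), Set.mk_mem_prod j.2 t.2⟩

/-- The vector `z(t) = (z_k(t), …, z_l(t))`. -/
def slice (R : Box) (z : C(↥R.region, ℝ)) (t : R.Time) : R.Layer → ℝ :=
  fun j => z (R.pt j t)

/-- Lebesgue measure on `[a, b]`. -/
def timeMeasure (R : Box) : Measure R.Time := (volume : Measure ℝ).comap Subtype.val

/-- The initial time `a`. -/
def left (R : Box) : R.Time := ⟨R.a, le_refl _, R.hab.le⟩

/-- The final time `b`. -/
def right (R : Box) : R.Time := ⟨R.b, R.hab.le, le_refl _⟩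

/-- The elapsed time `t - a`, as a nonnegative real. -/
def elapsed (R : Box) (t : R.Time) : ℝ≥0 := ⟨(t : ℝ) - R.a, sub_nonneg.2 t.2.1⟩

end Box

/-! ### Laws of shifted Brownian motions and Brownian bridges -/

/-- `(W j)` are independent standard Brownian motions on `[0, ∞)` started at `0`. -/
structure IsIndepBrownian {ι Ω : Type*} [MeasurableSpace Ω]
    (W : ι → ℝ≥0 → Ω → ℝ) (P : Measure Ω) : Prop where
  measurable : ∀ j s, Measurable (W j s)
  isBrownian : ∀ j, IsBrownianReal (W j) P
  indep : iIndepFun (fun j ω s => W j s ω) P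

/-- `γ` is the law on `C(R, ℝ)` of `B_j(t) + x_j + η_j(t)`, where the `B_j`, `B_j(t) = W_j(t - a)`,
are independent standard Brownian motions on `[a, b]` with `B_j(a) = 0`. -/
def IsShiftedWienerLaw (R : Box) (x : R.Layer → ℝ) (η : C(↥R.region, ℝ))
    (γ : Measure C(↥R.region, ℝ)) : Prop :=
  ∃ (Ω : Type) (_ : MeasurableSpace Ω) (P : Measure Ω)
    (W : R.Layer → ℝ≥0 → Ω → ℝ) (Z : Ω → C(↥R.region, ℝ)),
    IsIndepBrownian W P ∧ HasLaw Z γ P ∧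
    ∀ᵐ ω ∂P, ∀ (j : R.Layer) (t : R.Time),
      Z ω (R.pt j t) = W j (R.elapsed t) ω + x j + η (R.pt j t)

/-- `γ` is the law on `C(R, ℝ)` of
`B_j(t) + ((b - t) x_j + (t - a) y_j) / (b - a) + η_j(t)`, where the `B_j`,
`B_j(t) = W_j(t - a) - (t - a) / (b - a) * W_j(b - a)`, are independent Brownian bridges on
`[a, b]` with `B_j(a) = B_j(b) = 0`. -/
def IsShiftedBridgeLaw (R : Box) (x y : R.Layer → ℝ) (η : C(↥R.region, ℝ))
    (γ : Measure C(↥R.region, ℝ)) : Prop :=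
  ∃ (Ω : Type) (_ : MeasurableSpace Ω) (P : Measure Ω)
    (W : R.Layer → ℝ≥0 → Ω → ℝ) (Z : Ω → C(↥R.region, ℝ)),
    IsIndepBrownian W P ∧ HasLaw Z γ P ∧
    ∀ᵐ ω ∂P, ∀ (j : R.Layer) (t : R.Time),
      Z ω (R.pt j t) =
        (W j (R.elapsed t) ω -
          ((t : ℝ) - R.a) / (R.b - R.a) * W j (R.elapsed R.right) ω) +
        ((R.b - (t : ℝ)) * x j + ((t : ℝ) - R.a) * y j) / (R.b - R.a) + η (R.pt j t)

/-! ### Convex Hamiltonians and the Gibbs measures they define -/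

/-- The data of a convex Hamiltonian on `C(⟦k, l⟧ × [a, b], ℝ)`. -/
structure Hamiltonian (R : Box) where
  m : ℕ
  τ : Fin m → R.Time
  f : Fin m → (R.Layer → ℝ) → ℝ
  F : R.Time → (R.Layer → ℝ) → ℝ
  convex_f : ∀ i, ConvexOn ℝ Set.univ (f i)
  continuous_F : Continuous (Function.uncurry F)
  convex_F : ∀ t, ConvexOn ℝ Set.univ (F t)

/-- `H(z) = ∑ i, f_i(z(τ_i)) + ∫_a^b F(t, z(t)) dt`. -/
def Hamiltonian.eval {R : Box} (H : Hamiltonian R) (z : C(↥R.region, ℝ)) : ℝ :=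
  (∑ i, H.f i (R.slice z (H.τ i))) + ∫ t : R.Time, H.F t (R.slice z t) ∂(R.timeMeasure)

/-- The probability measures proportional to `exp (-H) γ`, with `γ` the law of shifted independent
Brownian motions or Brownian bridges. Here `Measure.tilted` is the normalized exponential tilt
`dμ = exp (-H) dγ / ∫ exp (-H) dγ`. -/
inductive IsPerturbation (R : Box) (μ : ProbabilityMeasure C(↥R.region, ℝ)) : Prop
  | free (x : R.Layer → ℝ) (η : C(↥R.region, ℝ))
      (hη : ∀ j, η (R.pt j R.left) = 0)
      (γ : Measure C(↥R.region, ℝ)) (hγ : IsShiftedWienerLaw R x η γ)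
      (H : Hamiltonian R)
      (hμ : (μ : Measure C(↥R.region, ℝ)) = γ.tilted (fun z => -H.eval z)) :
      IsPerturbation R μ
  | bridge (x y : R.Layer → ℝ) (η : C(↥R.region, ℝ))
      (hη : ∀ j, η (R.pt j R.left) = 0) (hη' : ∀ j, η (R.pt j R.right) = 0)
      (γ : Measure C(↥R.region, ℝ)) (hγ : IsShiftedBridgeLaw R x y η γ)
      (H : Hamiltonian R)
      (hμ : (μ : Measure C(↥R.region, ℝ)) = γ.tilted (fun z => -H.eval z)) :
      IsPerturbation R μ

/-! ### Local weak convergence and the class LC -/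

/-- Restriction of a continuous function on `D` to a subset `K`. -/
def res {D K : Set (ℤ × ℝ)} (h : K ⊆ D) (z : C(↥D, ℝ)) : C(↥K, ℝ) :=
  z.comp ⟨Set.inclusion h, continuous_inclusion h⟩

theorem continuous_res {D K : Set (ℤ × ℝ)} (h : K ⊆ D) : Continuous (res h) :=
  ContinuousMap.continuous_precomp _

/-- The marginal law on `C(K, ℝ)` of a law on `C(D, ℝ)`. -/
def marginal {D K : Set (ℤ × ℝ)} (μ : ProbabilityMeasure C(↥D, ℝ)) (h : K ⊆ D) :
    ProbabilityMeasure C(↥K, ℝ) :=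
  μ.map (continuous_res h).measurable.aemeasurable

/-- Local weak convergence of laws on `C(D i, ℝ)` to a law on `C(D', ℝ)`: `D i ⊆ D'` for all `i`,
and every compact `K ⊆ D'` is contained in `D i` for all large `i`, with the marginal laws on
`C(K, ℝ)` converging weakly. -/
structure TendstoLocallyWeakly {D : ℕ → Set (ℤ × ℝ)} {D' : Set (ℤ × ℝ)}
    (μ : ∀ i, ProbabilityMeasure C(↥(D i), ℝ)) (ν : ProbabilityMeasure C(↥D', ℝ)) : Prop where
  subset : ∀ i, D i ⊆ D'
  tendsto : ∀ (K : Set (ℤ × ℝ)) (hK : K ⊆ D'), IsCompact K →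
    ∃ (N : ℕ) (h : ∀ i, K ⊆ D (N + i)),
      Tendsto (fun i => marginal (μ (N + i)) (h i)) atTop (𝓝 (marginal ν hK))

/-- A random continuous function `L` on `Λ × I` is in the class `LC` if its law is the local weak
limit of a sequence of log-concave perturbations of Brownian motions or Brownian bridges. -/
def InLC {Λ : Set ℤ} {I : Set ℝ} {Ω : Type*} [MeasurableSpace Ω] (P : Measure Ω)
    (L : Ω → C(↥(Λ ×ˢ I), ℝ)) : Prop :=
  ∃ ν : ProbabilityMeasure C(↥(Λ ×ˢ I), ℝ),
    HasLaw L (ν : Measure C(↥(Λ ×ˢ I), ℝ)) P ∧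
    ∃ (R : ℕ → Box) (μ : ∀ i, ProbabilityMeasure C(↥(R i).region, ℝ)),
      (∀ i, IsPerturbation (R i) (μ i)) ∧ TendstoLocallyWeakly μ ν

end LineEnsemble

end

/-! The property carried through the proof is the Prékopa–Leindler inequality, a functional form of
log-concavity. It is stable under every operation in the construction: affine images, products,
multiplication by `exp (-V)` with `V` convex, and weak limits.

On the line it follows from Brunn–Minkowski applied to superlevel sets. Multiplying by a log-concave
density gives it for the standard Gaussian; products and affine images then give it for all Gaussian
laws on finite-dimensional spaces, degenerate ones included. This stage uses measurable test
functions, because Fubini produces fibre integrals.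

Next, the test functions become bounded and continuous, so that the inequality survives weak limits.
Brownian motions and bridges have Gaussian marginals, and a law on `C(X, ℝ)` is a weak limit of
finite-rank images of its marginals, so the inequality holds on path space. Hamiltonians are
continuous and convex there, so the tilts and their local weak limits satisfy it too. Finally, on
`ℝⁿ`, thickened indicators of compact sets together with inner regularity give back the inequality
for sets. -/

namespace LineEnsemble

/-! ### The Prékopa–Leindler inequality -/

/-- The one-dimensional Brunn–Minkowski inequality for compact sets. -/
theorem volume_add_le_volume_add_of_isCompact {A B : Set ℝ} (hA : IsCompact A) (hB : IsCompact B)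
    (hA' : A.Nonempty) (hB' : B.Nonempty) : volume A + volume B ≤ volume (A + B) := by
  obtain ⟨a, haA, ha⟩ := hA.exists_isGreatest hA'
  obtain ⟨b, hbB, hb⟩ := hB.exists_isLeast hB'
  -- With `a = max A` and `b = min B`, one translate lies to the left of `a + b` and the other to
  -- its right, so they overlap in at most one point.
  have hsub : (b +ᵥ A) ∪ (a +ᵥ B) ⊆ A + B := by
    rintro z (⟨x, hx, rfl⟩ | ⟨y, hy, rfl⟩)
    · exact ⟨x, hx, b, hbB, by simp [add_comm]⟩
    · exact ⟨a, haA, y, hy, by simp⟩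
  have hint : volume ((b +ᵥ A) ∩ (a +ᵥ B)) = 0 := by
    refine measure_mono_null ?_ (Real.volume_singleton (a := a + b))
    rintro z ⟨⟨x, hx, rfl⟩, ⟨y, hy, hxy⟩⟩
    have h1 := ha hx
    have h2 := hb hy
    simp only [vadd_eq_add] at hxy ⊢
    simp only [Set.mem_singleton_iff]
    linarith
  calc volume A + volume B = volume (b +ᵥ A) + volume (a +ᵥ B) := by simp only [measure_vadd]
    _ = volume ((b +ᵥ A) ∪ (a +ᵥ B)) := by
      rw [← measure_union_add_inter _ (hB.measurableSet.const_vadd a), hint, add_zero]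
    _ ≤ volume (A + B) := measure_mono hsub

/-- The one-dimensional Brunn–Minkowski inequality. -/
theorem volume_add_le_volume_add {A B : Set ℝ} (hA : MeasurableSet A) (hB : MeasurableSet B)
    (hA' : A.Nonempty) (hB' : B.Nonempty) : volume A + volume B ≤ volume (A + B) := by
  obtain ⟨a, ha⟩ := hA'
  obtain ⟨b, hb⟩ := hB'
  have key : ∀ K ⊆ A, IsCompact K → ∀ L ⊆ B, IsCompact L →
      volume K + volume L ≤ volume (A + B) := by
    intro K hK hKc L hL hLc
    -- The approximating compacts may be empty; inserting the fixed points `a` and `b` makes them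
    -- nonempty without leaving `A` and `B`.
    calc volume K + volume L ≤ volume (insert a K) + volume (insert b L) := by
          gcongr <;> exact Set.subset_insert _ _
      _ ≤ volume (insert a K + insert b L) :=
          volume_add_le_volume_add_of_isCompact (hKc.insert a) (hLc.insert b)
            (Set.insert_nonempty _ _) (Set.insert_nonempty _ _)
      _ ≤ volume (A + B) :=
          measure_mono (Set.add_subset_add (Set.insert_subset ha hK) (Set.insert_subset hb hL))
  rw [hA.measure_eq_iSup_isCompact, hB.measure_eq_iSup_isCompact]
  simp_rw [iSup_and']
  exact ENNReal.biSup_add_biSup_le' ⟨∅, Set.empty_subset _, isCompact_empty⟩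
    ⟨∅, Set.empty_subset _, isCompact_empty⟩ fun K hK L hL => key K hK.1 hK.2 L hL.1 hL.2

/-- The weighted arithmetic-geometric mean inequality in `ℝ≥0∞`. -/
theorem ENNReal_geom_mean_le_arith_mean {θ : ℝ} (h0 : 0 < θ) (h1 : θ < 1) (a b : ℝ≥0∞) :
    a ^ θ * b ^ (1 - θ) ≤ ENNReal.ofReal θ * a + ENNReal.ofReal (1 - θ) * b := by
  have h1' : 0 < 1 - θ := sub_pos.2 h1
  induction a with
  | top => simp [ENNReal.mul_top, h0]
  | coe a =>
    induction b with
    | top => simp [ENNReal.mul_top, h1]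
    | coe b =>
      have := NNReal.geom_mean_le_arith_mean2_weighted ⟨θ, h0.le⟩ ⟨1 - θ, h1'.le⟩ a b
        (NNReal.eq (add_sub_cancel θ 1))
      rw [← ENNReal.coe_rpow_of_nonneg _ h0.le, ← ENNReal.coe_rpow_of_nonneg _ h1'.le,
        ENNReal.ofReal_eq_coe_nnreal h0.le, ENNReal.ofReal_eq_coe_nnreal h1'.le]
      exact_mod_cast this

/-- The layer cake formula for functions with values in `[0, 1]`. -/
theorem lintegral_eq_lintegral_Ioo_meas_lt {α : Type*} [MeasurableSpace α] (μ : Measure α)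
    {f : α → ℝ≥0∞} (hf : Measurable f) (hf1 : ∀ x, f x ≤ 1) :
    ∫⁻ x, f x ∂μ = ∫⁻ t in Set.Ioo (0 : ℝ) 1, μ {x | ENNReal.ofReal t < f x} := by
  have hfin : ∀ x, f x ≠ ∞ := fun x => ((hf1 x).trans_lt ENNReal.one_lt_top).ne
  have hset : ∀ t : ℝ, 0 ≤ t → {x | t < (f x).toReal} = {x | ENNReal.ofReal t < f x} := by
    intro t ht
    ext x
    simp [ENNReal.ofReal_lt_iff_lt_toReal ht (hfin x)]
  calc ∫⁻ x, f x ∂μ = ∫⁻ x, ENNReal.ofReal (f x).toReal ∂μ := by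
        simp_rw [ENNReal.ofReal_toReal (hfin _)]
    _ = ∫⁻ t in Set.Ioi 0, μ {x | t < (f x).toReal} :=
        lintegral_eq_lintegral_meas_lt μ (ae_of_all _ fun x => ENNReal.toReal_nonneg)
          hf.ennreal_toReal.aemeasurable
    _ = ∫⁻ t in Set.Ioi 0, μ {x | ENNReal.ofReal t < f x} :=
        setLIntegral_congr_fun measurableSet_Ioi fun t ht => by
          simp only [hset t (le_of_lt ht)]
    _ = ∫⁻ t in Set.Ioo (0 : ℝ) 1, μ {x | ENNReal.ofReal t < f x} := by
        have hzero : ∫⁻ t in Set.Ici (1 : ℝ), μ {x | ENNReal.ofReal t < f x} = 0 := by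
          refine setLIntegral_eq_zero measurableSet_Ici fun t ht => ?_
          have : {x | ENNReal.ofReal t < f x} = ∅ := by
            ext x
            simpa using (hf1 x).trans (by simpa using ht)
          simp [this]
        rw [← Set.Ioo_union_Ici_eq_Ioi (zero_lt_one' ℝ),
          lintegral_union measurableSet_Ici
            (Set.disjoint_left.2 fun t ht ht' => not_le.2 ht.2 ht'), hzero, add_zero]

/-- The one-dimensional Prékopa–Leindler inequality, for functions with supremum `1`. -/
theorem prekopaLeindler_of_iSup_eq_one {θ : ℝ} (h0 : 0 < θ) (h1 : θ < 1) {f g h : ℝ → ℝ≥0∞}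
    (hf : Measurable f) (hg : Measurable g) (hh : Measurable h)
    (hf1 : ⨆ x, f x = 1) (hg1 : ⨆ x, g x = 1)
    (hfgh : ∀ x y, f x ^ θ * g y ^ (1 - θ) ≤ h (θ • x + (1 - θ) • y)) :
    (∫⁻ x, f x) ^ θ * (∫⁻ x, g x) ^ (1 - θ) ≤ ∫⁻ x, h x := by
  have h1' : 0 < 1 - θ := sub_pos.2 h1
  -- Since both suprema are `1`, even the arithmetic mean of the integrals is bounded by the
  -- integral of `h`. This bound is linear, so it can be checked level by level.
  refine (ENNReal_geom_mean_le_arith_mean h0 h1 _ _).trans ?_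
  have hfle : ∀ x, f x ≤ 1 := fun x => (le_iSup f x).trans hf1.le
  have hgle : ∀ x, g x ≤ 1 := fun x => (le_iSup g x).trans hg1.le
  have hanti : ∀ u : ℝ → ℝ≥0∞, Measurable fun t : ℝ => volume {x | ENNReal.ofReal t < u x} :=
    fun u => Antitone.measurable fun s t hst =>
      measure_mono fun x hx => (ENNReal.ofReal_le_ofReal hst).trans_lt hx
  calc ENNReal.ofReal θ * (∫⁻ x, f x) + ENNReal.ofReal (1 - θ) * ∫⁻ x, g x
      = ∫⁻ t in Set.Ioo (0 : ℝ) 1, (ENNReal.ofReal θ * volume {x | ENNReal.ofReal t < f x} +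
          ENNReal.ofReal (1 - θ) * volume {x | ENNReal.ofReal t < g x}) := by
        rw [lintegral_eq_lintegral_Ioo_meas_lt _ hf hfle,
          lintegral_eq_lintegral_Ioo_meas_lt _ hg hgle,
          lintegral_add_left ((hanti f).const_mul _), lintegral_const_mul _ (hanti f),
          lintegral_const_mul _ (hanti g)]
    -- For `t < 1` the superlevel sets of `f` and `g` are nonempty, and their weighted Minkowski sum
    -- lies in that of `h`, so Brunn–Minkowski applies.
    _ ≤ ∫⁻ t in Set.Ioo (0 : ℝ) 1, volume {x | ENNReal.ofReal t < min (h x) 1} := by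
        refine setLIntegral_mono (hanti _) fun t ht => ?_
        have hsc : ∀ (r : ℝ), 0 < r → ∀ s : Set ℝ,
            ENNReal.ofReal r * volume s = volume (r • s) := fun r hr s => by
          simp [Measure.addHaar_smul, abs_of_pos hr]
        rw [hsc θ h0, hsc (1 - θ) h1']
        have ht1 : ENNReal.ofReal t < 1 := by simpa using ht.2
        have hne : ∀ u : ℝ → ℝ≥0∞, ⨆ x, u x = 1 → {x | ENNReal.ofReal t < u x}.Nonempty :=
          fun u hu => lt_iSup_iff.1 (ht1.trans_eq hu.symm)
        refine (volume_add_le_volume_add ((measurableSet_lt measurable_const hf).const_smul₀ θ)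
          ((measurableSet_lt measurable_const hg).const_smul₀ (1 - θ)) (hne f hf1).smul_set
          (hne g hg1).smul_set).trans (measure_mono ?_)
        rintro _ ⟨_, ⟨x, hx, rfl⟩, _, ⟨y, hy, rfl⟩, rfl⟩
        refine lt_min (lt_of_lt_of_le ?_ (hfgh x y)) ht1
        calc ENNReal.ofReal t = ENNReal.ofReal t ^ θ * ENNReal.ofReal t ^ (1 - θ) := by
              rw [← ENNReal.rpow_add _ _ (by simpa using ht.1) ENNReal.ofReal_ne_top]
              simp
          _ < f x ^ θ * g y ^ (1 - θ) :=
              ENNReal.mul_lt_mul (ENNReal.rpow_lt_rpow hx h0) (ENNReal.rpow_lt_rpow hy h1')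
    _ = ∫⁻ x, min (h x) 1 :=
        (lintegral_eq_lintegral_Ioo_meas_lt _ (hh.min measurable_const)
          fun x => min_le_right _ _).symm
    _ ≤ ∫⁻ x, h x := lintegral_mono fun x => min_le_left _ _

/-- The one-dimensional Prékopa–Leindler inequality. -/
theorem prekopaLeindler {θ : ℝ} (h0 : 0 < θ) (h1 : θ < 1) {f g h : ℝ → ℝ≥0∞}
    (hf : Measurable f) (hg : Measurable g) (hh : Measurable h)
    (hf1 : ∀ x, f x ≤ 1) (hg1 : ∀ x, g x ≤ 1)
    (hfgh : ∀ x y, f x ^ θ * g y ^ (1 - θ) ≤ h (θ • x + (1 - θ) • y)) :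
    (∫⁻ x, f x) ^ θ * (∫⁻ x, g x) ^ (1 - θ) ≤ ∫⁻ x, h x := by
  have h1' : 0 < 1 - θ := sub_pos.2 h1
  have hzero : ∀ u : ℝ → ℝ≥0∞, ⨆ x, u x = 0 → ∫⁻ x, u x = 0 := fun u hu => by
    simp [ENNReal.iSup_eq_zero.1 hu]
  by_cases hF : ⨆ x, f x = 0
  · simp [hzero f hF, ENNReal.zero_rpow_of_pos h0]
  by_cases hG : ⨆ x, g x = 0
  · simp [hzero g hG, ENNReal.zero_rpow_of_pos h1']
  -- The bound by `1` serves only to keep the suprema finite, so that `f`, `g`, `h` can be divided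
  -- by `F`, `G` and `F ^ θ * G ^ (1 - θ)`.
  have hF' : ⨆ x, f x ≠ ∞ := ((iSup_le hf1).trans_lt ENNReal.one_lt_top).ne
  have hG' : ⨆ x, g x ≠ ∞ := ((iSup_le hg1).trans_lt ENNReal.one_lt_top).ne
  set F := ⨆ x, f x with hFdef
  set G := ⨆ x, g x with hGdef
  set c := F ^ θ * G ^ (1 - θ) with hc
  have hc0 : c ≠ 0 := by
    simp [hc, hF, hG, hF', hG', ENNReal.rpow_eq_zero_iff]
  have hctop : c ≠ ∞ := by
    simp [hc, hF, hG, hF', hG', ENNReal.mul_eq_top, ENNReal.rpow_eq_top_iff]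
  have hdiv : ∀ a b : ℝ≥0∞, (a * F⁻¹) ^ θ * (b * G⁻¹) ^ (1 - θ) =
      (a ^ θ * b ^ (1 - θ)) * c⁻¹ := fun a b => by
    rw [ENNReal.mul_rpow_of_nonneg _ _ h0.le, ENNReal.mul_rpow_of_nonneg _ _ h1'.le,
      ENNReal.inv_rpow, ENNReal.inv_rpow, hc, ENNReal.mul_inv (Or.inr (by simp [hG, hG']))
        (Or.inr (by simp [hG, hG']))]
    ring
  have := prekopaLeindler_of_iSup_eq_one h0 h1 (f := fun x => f x * F⁻¹) (g := fun x => g x * G⁻¹)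
    (h := fun x => h x * c⁻¹) (hf.mul_const _) (hg.mul_const _) (hh.mul_const _)
    (by rw [← ENNReal.iSup_mul, ← hFdef, ENNReal.mul_inv_cancel hF hF'])
    (by rw [← ENNReal.iSup_mul, ← hGdef, ENNReal.mul_inv_cancel hG hG'])
    (fun x y => by rw [hdiv]; gcongr; exact hfgh x y)
  rw [lintegral_mul_const _ hf, lintegral_mul_const _ hg, lintegral_mul_const _ hh, hdiv] at this
  exact (ENNReal.mul_le_mul_iff_left (by simp [hctop]) (by simp [hc0])).1 this

/-! ### Measures satisfying the Prékopa–Leindler inequality for measurable functions -/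

/-- The Prékopa–Leindler inequality for measurable functions with values in `[0, 1]`. -/
def IsMeasurablePrekopaLeindler {E : Type*} [MeasurableSpace E] [AddCommGroup E] [Module ℝ E]
    (μ : Measure E) : Prop :=
  ∀ θ : ℝ, 0 < θ → θ < 1 → ∀ f g h : E → ℝ≥0∞, Measurable f → Measurable g → Measurable h →
    (∀ x, f x ≤ 1) → (∀ x, g x ≤ 1) →
    (∀ x y, f x ^ θ * g y ^ (1 - θ) ≤ h (θ • x + (1 - θ) • y)) →
      (∫⁻ x, f x ∂μ) ^ θ * (∫⁻ x, g x ∂μ) ^ (1 - θ) ≤ ∫⁻ x, h x ∂μ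

namespace IsMeasurablePrekopaLeindler

variable {E F : Type*} [MeasurableSpace E] [AddCommGroup E] [Module ℝ E]
  [MeasurableSpace F] [AddCommGroup F] [Module ℝ F]

theorem map {μ : Measure E} (hμ : IsMeasurablePrekopaLeindler μ) {T : E → F} (hT : Measurable T)
    (haff : ∀ (θ : ℝ) (x y : E), T (θ • x + (1 - θ) • y) = θ • T x + (1 - θ) • T y) :
    IsMeasurablePrekopaLeindler (μ.map T) := by
  intro θ h0 h1 f g h hf hg hh hf1 hg1 hfgh
  rw [lintegral_map hf hT, lintegral_map hg hT, lintegral_map hh hT]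
  exact hμ θ h0 h1 _ _ _ (hf.comp hT) (hg.comp hT) (hh.comp hT) (fun _ => hf1 _) (fun _ => hg1 _)
    fun x y => by rw [haff]; exact hfgh _ _

theorem dirac (x : E) : IsMeasurablePrekopaLeindler (Measure.dirac x) := by
  intro θ h0 h1 f g h hf hg hh hf1 hg1 hfgh
  rw [lintegral_dirac' _ hf, lintegral_dirac' _ hg, lintegral_dirac' _ hh]
  simpa [← add_smul] using hfgh x x

/-- For fixed `x` and `x'`, the inequality for `ν` on the fibres is exactly the hypothesis needed to
apply the inequality for `μ` to the fibre integrals. Total mass one keeps these integrals in `[0,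
1]`. -/
theorem prod {μ : Measure E} {ν : Measure F} [IsProbabilityMeasure μ] [IsProbabilityMeasure ν]
    (hμ : IsMeasurablePrekopaLeindler μ) (hν : IsMeasurablePrekopaLeindler ν) :
    IsMeasurablePrekopaLeindler (μ.prod ν) := by
  intro θ h0 h1 f g h hf hg hh hf1 hg1 hfgh
  have hle : ∀ u : E × F → ℝ≥0∞, (∀ z, u z ≤ 1) → ∀ x, ∫⁻ y, u (x, y) ∂ν ≤ 1 :=
    fun u hu x => (lintegral_mono fun y => hu (x, y)).trans (by simp)
  rw [lintegral_prod _ hf.aemeasurable, lintegral_prod _ hg.aemeasurable,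
    lintegral_prod _ hh.aemeasurable]
  refine hμ θ h0 h1 _ _ _ hf.lintegral_prod_right' hg.lintegral_prod_right'
    hh.lintegral_prod_right' (hle f hf1) (hle g hg1) fun x x' => ?_
  exact hν θ h0 h1 _ _ _ (hf.comp measurable_prodMk_left) (hg.comp measurable_prodMk_left)
    (hh.comp measurable_prodMk_left) (fun _ => hf1 _) (fun _ => hg1 _)
    fun y y' => hfgh (x, y) (x', y')

theorem pi {n : ℕ} {μ : Fin n → Measure ℝ} [∀ i, IsProbabilityMeasure (μ i)]
    (hμ : ∀ i, IsMeasurablePrekopaLeindler (μ i)) :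
    IsMeasurablePrekopaLeindler (Measure.pi μ) := by
  induction n with
  | zero => rw [Measure.pi_of_empty μ 0]; exact dirac _
  | succ n ih =>
    rw [← ((measurePreserving_piFinSuccAbove μ 0).symm _).map_eq]
    refine ((hμ 0).prod (ih fun j => hμ _)).map (MeasurableEquiv.measurable _) fun θ x y => ?_
    ext i
    refine Fin.cases ?_ (fun j => ?_) i <;>
      simp [MeasurableEquiv.piFinSuccAbove]

end IsMeasurablePrekopaLeindler

/-! ### Gaussian measures -/

theorem isMeasurablePrekopaLeindler_gaussianReal :
    IsMeasurablePrekopaLeindler (gaussianReal 0 1) := by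
  intro θ h0 h1 f g h hf hg hh hf1 hg1 hfgh
  have h1' : 0 < 1 - θ := sub_pos.2 h1
  have hm := measurable_gaussianPDF 0 1
  have hpdf1 : ∀ x, gaussianPDF 0 1 x ≤ 1 := by
    intro x
    rw [gaussianPDF, ENNReal.ofReal_le_one, gaussianPDFReal]
    have hs : (1 : ℝ) ≤ √(2 * Real.pi * ((1 : ℝ≥0) : ℝ)) := by
      rw [Real.one_le_sqrt]
      have := Real.pi_gt_three
      simp only [NNReal.coe_one]
      linarith
    exact mul_le_one₀ (inv_le_one_of_one_le₀ hs) (Real.exp_nonneg _)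
      (Real.exp_le_one_iff.2 (div_nonpos_of_nonpos_of_nonneg (by nlinarith [sq_nonneg (x - 0)])
        (by simp)))
  have hpdf : ∀ x y, gaussianPDF 0 1 x ^ θ * gaussianPDF 0 1 y ^ (1 - θ) ≤
      gaussianPDF 0 1 (θ • x + (1 - θ) • y) := by
    intro x y
    simp only [gaussianPDF]
    rw [ENNReal.ofReal_rpow_of_nonneg (gaussianPDFReal_nonneg _ _ _) h0.le,
      ENNReal.ofReal_rpow_of_nonneg (gaussianPDFReal_nonneg _ _ _) h1'.le,
      ← ENNReal.ofReal_mul (Real.rpow_nonneg (gaussianPDFReal_nonneg _ _ _) _)]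
    apply ENNReal.ofReal_le_ofReal
    simp only [gaussianPDFReal]
    have hc : 0 < (√(2 * Real.pi * ((1 : ℝ≥0) : ℝ)))⁻¹ := by
      simp only [NNReal.coe_one]; positivity
    set c := (√(2 * Real.pi * ((1 : ℝ≥0) : ℝ)))⁻¹
    rw [Real.mul_rpow hc.le (Real.exp_nonneg _), Real.mul_rpow hc.le (Real.exp_nonneg _),
      mul_mul_mul_comm, ← Real.rpow_add hc, ← Real.exp_mul, ← Real.exp_mul, ← Real.exp_add]
    simp only [add_sub_cancel, Real.rpow_one, NNReal.coe_one, smul_eq_mul]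
    gcongr
    -- Convexity of the square: `θ x² + (1 - θ) y² - (θ x + (1 - θ) y)² = θ (1 - θ) (x - y)²`.
    nlinarith [mul_nonneg (mul_nonneg h0.le h1'.le) (sq_nonneg (x - y))]
  have hint : ∀ u : ℝ → ℝ≥0∞, Measurable u →
      ∫⁻ x, u x ∂(gaussianReal 0 1) = ∫⁻ x, gaussianPDF 0 1 x * u x := fun u hu => by
    rw [gaussianReal_of_var_ne_zero _ one_ne_zero,
      lintegral_withDensity_eq_lintegral_mul _ hm hu]
    rfl
  rw [hint f hf, hint g hg, hint h hh]
  refine prekopaLeindler h0 h1 (hm.mul hf) (hm.mul hg) (hm.mul hh)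
    (fun x => mul_le_one' (hpdf1 x) (hf1 x)) (fun x => mul_le_one' (hpdf1 x) (hg1 x))
    fun x y => ?_
  rw [ENNReal.mul_rpow_of_nonneg _ _ h0.le, ENNReal.mul_rpow_of_nonneg _ _ h1'.le,
    mul_mul_mul_comm]
  exact mul_le_mul' (hpdf x y) (hfgh x y)

/-- This measure is by construction an affine image of a product of standard Gaussians, so a
singular `S` needs no separate treatment. -/
theorem isMeasurablePrekopaLeindler_multivariateGaussian {ι : Type*} [Fintype ι] [DecidableEq ι]
    (m : EuclideanSpace ℝ ι) (S : Matrix ι ι ℝ) :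
    IsMeasurablePrekopaLeindler (multivariateGaussian m S) := by
  rw [multivariateGaussian, stdGaussian]
  refine ((IsMeasurablePrekopaLeindler.pi fun _ => isMeasurablePrekopaLeindler_gaussianReal).map
    (by fun_prop) fun θ x y => ?_).map (by fun_prop) fun θ x y => ?_
  · simp [add_smul, mul_smul, Finset.sum_add_distrib, Finset.smul_sum]
  · simp only [map_add, map_smul]
    module

/-- Every Gaussian law on `ℝⁿ` satisfies the Prékopa–Leindler inequality. -/
theorem isMeasurablePrekopaLeindler_of_isGaussian {ι : Type*} [Fintype ι] (μ : Measure (ι → ℝ))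
    [IsGaussian μ] : IsMeasurablePrekopaLeindler μ := by
  classical
  set ν : Measure (EuclideanSpace ℝ ι) := μ.map (EuclideanSpace.equiv ι ℝ).symm with hν
  have : IsGaussian ν := by rw [hν]; infer_instance
  set S : Matrix ι ι ℝ := Matrix.of fun i j => cov[fun x => x i, fun x => x j; μ] with hS
  have hmem : ∀ i, MemLp (fun x : ι → ℝ => x i) 2 μ :=
    fun i => (IsGaussian.hasGaussianLaw_id.eval i).memLp_two
  have hquad : ∀ x y : EuclideanSpace ℝ ι,
      covarianceBilin ν x y = x.ofLp ⬝ᵥ S.mulVec y.ofLp := by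
    intro x y
    have := covarianceBilin_apply_pi hmem x y
    rw [show ν = μ.map fun ω => WithLp.toLp 2 fun i => ω i from rfl, this]
    simp only [dotProduct, Matrix.mulVec, Finset.mul_sum, hS, Matrix.of_apply]
    exact Finset.sum_congr rfl fun i _ => Finset.sum_congr rfl fun j _ => by ring
  have hpos : S.PosSemidef := by
    refine Matrix.PosSemidef.of_dotProduct_mulVec_nonneg ?_ fun x => ?_
    · ext i j
      simp [hS, covariance_comm]
    · have := hquad (WithLp.toLp 2 x) (WithLp.toLp 2 x)
      simp only [star_trivial]
      rw [← this]
      exact isPosSemidef_covarianceBilin.nonneg _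
  -- A Gaussian law is determined by its mean and covariance.
  have hG : ν = multivariateGaussian (∫ x, x ∂ν) S := by
    apply IsGaussian.ext
    · simp
    · ext x y
      rw [hquad, covarianceBilin_multivariateGaussian hpos]
  have hμ : μ = ν.map (EuclideanSpace.equiv ι ℝ) := by
    rw [hν, Measure.map_map (by fun_prop) (by fun_prop)]
    simp
  rw [hμ, hG]
  exact (isMeasurablePrekopaLeindler_multivariateGaussian _ _).map (by fun_prop)
    fun θ x y => by simp

section

/-! ### Measures satisfying the Prékopa–Leindler inequality for continuous functions -/

/-- The Prékopa–Leindler inequality for nonnegative bounded continuous functions. -/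
def IsPrekopaLeindler {E : Type*} [TopologicalSpace E] [MeasurableSpace E] [AddCommGroup E]
    [Module ℝ E] (μ : Measure E) : Prop :=
  ∀ θ : ℝ, 0 < θ → θ < 1 → ∀ f g h : BoundedContinuousFunction E ℝ,
    (∀ x, 0 ≤ f x) → (∀ x, 0 ≤ g x) → (∀ x, 0 ≤ h x) →
    (∀ x y, f x ^ θ * g y ^ (1 - θ) ≤ h (θ • x + (1 - θ) • y)) →
      (∫ x, f x ∂μ) ^ θ * (∫ x, g x ∂μ) ^ (1 - θ) ≤ ∫ x, h x ∂μ

/-- The exponents sum to `1`, so the inequality is invariant under a common rescaling of its three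
functions. -/
theorem mul_rpow_mul_rpow_one_sub {θ a b c : ℝ} (ha : 0 ≤ a) (hb : 0 ≤ b) (hc : 0 < c) :
    (c * a) ^ θ * (c * b) ^ (1 - θ) = c * (a ^ θ * b ^ (1 - θ)) := by
  rw [Real.mul_rpow hc.le ha, Real.mul_rpow hc.le hb, mul_mul_mul_comm, ← Real.rpow_add hc]
  simp

variable {E F : Type*} [TopologicalSpace E] [MeasurableSpace E] [AddCommGroup E] [Module ℝ E]
  [TopologicalSpace F] [MeasurableSpace F] [AddCommGroup F] [Module ℝ F]

theorem IsMeasurablePrekopaLeindler.isPrekopaLeindler [OpensMeasurableSpace E] {μ : Measure E}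
    [IsFiniteMeasure μ] (hμ : IsMeasurablePrekopaLeindler μ) : IsPrekopaLeindler μ := by
  intro θ h0 h1 f g h hf hg hh hfgh
  have h1' : 0 < 1 - θ := sub_pos.2 h1
  -- Scaling by `c` brings `f` and `g` below `1`; the added `1` keeps `c` positive when both vanish.
  set c : ℝ := (max ‖f‖ ‖g‖ + 1)⁻¹ with hc
  have hcpos : 0 < c := by positivity
  have hle : ∀ u : BoundedContinuousFunction E ℝ, ‖u‖ ≤ max ‖f‖ ‖g‖ →
      ∀ x, ENNReal.ofReal (c * u x) ≤ 1 := by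
    intro u hu x
    rw [ENNReal.ofReal_le_one, hc, inv_mul_le_iff₀ (by positivity)]
    have := (le_abs_self _).trans (u.norm_coe_le_norm x)
    linarith
  have hmeas : ∀ u : BoundedContinuousFunction E ℝ,
      Measurable fun x => ENNReal.ofReal (c * u x) :=
    fun u => (u.continuous.measurable.const_mul c).ennreal_ofReal
  have hint : ∀ u : BoundedContinuousFunction E ℝ, (∀ x, 0 ≤ u x) →
      ∫⁻ x, ENNReal.ofReal (c * u x) ∂μ = ENNReal.ofReal (c * ∫ x, u x ∂μ) := by
    intro u hu
    rw [← integral_const_mul, ofReal_integral_eq_lintegral_ofReal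
      ((u.integrable μ).const_mul c) (ae_of_all _ fun x => mul_nonneg hcpos.le (hu x))]
  have key := hμ θ h0 h1 _ _ _ (hmeas f) (hmeas g) (hmeas h) (hle f (le_max_left _ _))
    (hle g (le_max_right _ _)) fun x y => by
      rw [ENNReal.ofReal_rpow_of_nonneg (mul_nonneg hcpos.le (hf x)) h0.le,
        ENNReal.ofReal_rpow_of_nonneg (mul_nonneg hcpos.le (hg y)) h1'.le,
        ← ENNReal.ofReal_mul (Real.rpow_nonneg (mul_nonneg hcpos.le (hf x)) _),
        mul_rpow_mul_rpow_one_sub (hf x) (hg y) hcpos]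
      exact ENNReal.ofReal_le_ofReal (mul_le_mul_of_nonneg_left (hfgh x y) hcpos.le)
  have hIf : 0 ≤ ∫ x, f x ∂μ := integral_nonneg hf
  have hIg : 0 ≤ ∫ x, g x ∂μ := integral_nonneg hg
  rw [hint f hf, hint g hg, hint h hh,
    ENNReal.ofReal_rpow_of_nonneg (mul_nonneg hcpos.le hIf) h0.le,
    ENNReal.ofReal_rpow_of_nonneg (mul_nonneg hcpos.le hIg) h1'.le,
    ← ENNReal.ofReal_mul (Real.rpow_nonneg (mul_nonneg hcpos.le hIf) _),
    mul_rpow_mul_rpow_one_sub hIf hIg hcpos,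
    ENNReal.ofReal_le_ofReal_iff (mul_nonneg hcpos.le (integral_nonneg hh))] at key
  exact le_of_mul_le_mul_left key hcpos

namespace IsPrekopaLeindler

theorem map [OpensMeasurableSpace E] [BorelSpace F] {μ : Measure E} (hμ : IsPrekopaLeindler μ)
    {T : E → F} (hT : Continuous T)
    (haff : ∀ (θ : ℝ) (x y : E), T (θ • x + (1 - θ) • y) = θ • T x + (1 - θ) • T y) :
    IsPrekopaLeindler (μ.map T) := by
  intro θ h0 h1 f g h hf hg hh hfgh
  have hint : ∀ u : BoundedContinuousFunction F ℝ,
      ∫ x, u x ∂(μ.map T) = ∫ x, u.compContinuous ⟨T, hT⟩ x ∂μ := fun u =>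
    integral_map hT.measurable.aemeasurable u.continuous.measurable.aestronglyMeasurable
  rw [hint, hint, hint]
  exact hμ θ h0 h1 _ _ _ (fun _ => hf _) (fun _ => hg _) (fun _ => hh _) fun x y => by
    simpa [haff] using hfgh (T x) (T y)

theorem of_tendsto {ι : Type*} {l : Filter ι} [l.NeBot] {μ : ι → Measure E} {ν : Measure E}
    (hμ : ∀ i, IsPrekopaLeindler (μ i))
    (hlim : ∀ f : BoundedContinuousFunction E ℝ,
      Tendsto (fun i => ∫ x, f x ∂(μ i)) l (𝓝 (∫ x, f x ∂ν))) :
    IsPrekopaLeindler ν := by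
  intro θ h0 h1 f g h hf hg hh hfgh
  exact le_of_tendsto_of_tendsto'
    (((hlim f).rpow_const (Or.inr h0.le)).mul ((hlim g).rpow_const (Or.inr (sub_pos.2 h1).le)))
    (hlim h) fun i => hμ i θ h0 h1 f g h hf hg hh hfgh

/-- Multiplying `f`, `g`, `h` by a log-concave weight preserves the pointwise hypothesis. Since `exp
(-V)` may be unbounded, `V` is replaced by `max V (-n)`, still convex, and dominated convergence
removes the truncation. -/
theorem mul_exp_neg [OpensMeasurableSpace E] {μ : Measure E} (hμ : IsPrekopaLeindler μ)
    {V : E → ℝ} (hV : Continuous V) (hVc : ConvexOn ℝ Set.univ V)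
    (hint : Integrable (fun x => Real.exp (-V x)) μ) {θ : ℝ} (h0 : 0 < θ) (h1 : θ < 1)
    (f g h : BoundedContinuousFunction E ℝ) (hf : ∀ x, 0 ≤ f x) (hg : ∀ x, 0 ≤ g x)
    (hh : ∀ x, 0 ≤ h x) (hfgh : ∀ x y, f x ^ θ * g y ^ (1 - θ) ≤ h (θ • x + (1 - θ) • y)) :
    (∫ x, Real.exp (-V x) * f x ∂μ) ^ θ * (∫ x, Real.exp (-V x) * g x ∂μ) ^ (1 - θ) ≤
      ∫ x, Real.exp (-V x) * h x ∂μ := by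
  have h1' : 0 < 1 - θ := sub_pos.2 h1
  have hcont : ∀ n : ℕ, Continuous fun x => Real.exp (-max (V x) (-(n : ℝ))) := fun n => by
    fun_prop
  let w : ℕ → BoundedContinuousFunction E ℝ := fun n =>
    BoundedContinuousFunction.ofNormedAddCommGroup _ (hcont n) (Real.exp n) fun x => by
      rw [Real.norm_eq_abs, Real.abs_exp, Real.exp_le_exp]
      linarith [le_max_right (V x) (-(n : ℝ))]
  have hw : ∀ n x, w n x = Real.exp (-max (V x) (-(n : ℝ))) := fun n x => rfl
  have hw0 : ∀ n x, 0 ≤ w n x := fun n x => (Real.exp_pos _).le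
  have hlim : ∀ u : BoundedContinuousFunction E ℝ,
      Tendsto (fun n => ∫ x, (w n * u) x ∂μ) atTop (𝓝 (∫ x, Real.exp (-V x) * u x ∂μ)) := by
    intro u
    refine tendsto_integral_of_dominated_convergence (fun x => Real.exp (-V x) * ‖u‖)
      (fun n => (w n * u).continuous.measurable.aestronglyMeasurable) (hint.mul_const _)
      (fun n => ae_of_all _ fun x => ?_) (ae_of_all _ fun x => ?_)
    · rw [BoundedContinuousFunction.mul_apply, norm_mul, hw, Real.norm_eq_abs, Real.abs_exp]
      exact mul_le_mul (Real.exp_le_exp.2 (neg_le_neg (le_max_left _ _)))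
        (u.norm_coe_le_norm x) (norm_nonneg _) (Real.exp_pos _).le
    · obtain ⟨N, hN⟩ := exists_nat_ge (-V x)
      refine tendsto_const_nhds.congr' ?_
      filter_upwards [eventually_ge_atTop N] with n hn
      have : (N : ℝ) ≤ n := by exact_mod_cast hn
      rw [BoundedContinuousFunction.mul_apply, hw, max_eq_left (by linarith)]
  refine le_of_tendsto_of_tendsto'
    (((hlim f).rpow_const (Or.inr h0.le)).mul ((hlim g).rpow_const (Or.inr h1'.le)))
    (hlim h) fun n => ?_
  refine hμ θ h0 h1 _ _ _ (fun x => mul_nonneg (hw0 n x) (hf x))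
    (fun x => mul_nonneg (hw0 n x) (hg x)) (fun x => mul_nonneg (hw0 n x) (hh x)) fun x y => ?_
  simp only [BoundedContinuousFunction.mul_apply]
  rw [Real.mul_rpow (hw0 n x) (hf x), Real.mul_rpow (hw0 n y) (hg y), mul_mul_mul_comm]
  refine mul_le_mul ?_ (hfgh x y)
    (mul_nonneg (Real.rpow_nonneg (hf x) _) (Real.rpow_nonneg (hg y) _)) (hw0 _ _)
  rw [hw, hw, hw, ← Real.exp_mul, ← Real.exp_mul, ← Real.exp_add, Real.exp_le_exp]
  have := (hVc.sup (convexOn_const (-(n : ℝ)) convex_univ)).2 (Set.mem_univ x) (Set.mem_univ y)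
    h0.le h1'.le (by ring)
  simp only [Pi.sup_apply, smul_eq_mul] at this
  linarith

theorem tilted [OpensMeasurableSpace E] {μ : Measure E} (hμ : IsPrekopaLeindler μ)
    {V : E → ℝ} (hV : Continuous V) (hVc : ConvexOn ℝ Set.univ V)
    (hint : Integrable (fun x => Real.exp (-V x)) μ) :
    IsPrekopaLeindler (μ.tilted fun x => -V x) := by
  intro θ h0 h1 f g h hf hg hh hfgh
  have key := hμ.mul_exp_neg hV hVc hint h0 h1 f g h hf hg hh hfgh
  set Z := ∫ x, Real.exp (-V x) ∂μ with hZ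
  have hI : ∀ u : BoundedContinuousFunction E ℝ, ∫ x, u x ∂(μ.tilted fun x => -V x) =
      Z⁻¹ * ∫ x, Real.exp (-V x) * u x ∂μ := by
    intro u
    rw [integral_tilted, ← integral_const_mul]
    refine integral_congr_ae (ae_of_all _ fun x => ?_)
    simp only [smul_eq_mul]
    ring
  have hnn : ∀ u : BoundedContinuousFunction E ℝ, (∀ x, 0 ≤ u x) →
      0 ≤ ∫ x, Real.exp (-V x) * u x ∂μ := fun u hu =>
    integral_nonneg fun x => mul_nonneg (Real.exp_pos _).le (hu x)
  rw [hI, hI, hI]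
  rcases (integral_nonneg fun x => (Real.exp_pos (-V x)).le : 0 ≤ Z).eq_or_lt with h | h
  -- Here `Z⁻¹ = 0` by convention, so every integral against the tilted measure vanishes.
  · rw [← hZ] at h
    simp [← h, Real.zero_rpow h0.ne']
  · rw [mul_rpow_mul_rpow_one_sub (hnn f hf) (hnn g hg) (inv_pos.2 h)]
    exact mul_le_mul_of_nonneg_left key (inv_pos.2 h).le

end IsPrekopaLeindler

/-! ### From continuous functions to sets -/

theorem coe_thickenedIndicator_eq_max {X : Type*} [PseudoMetricSpace X] {δ : ℝ} (hδ : 0 < δ)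
    {K : Set X} (hK : K.Nonempty) (x : X) :
    (thickenedIndicator hδ K x : ℝ) = max 0 (1 - Metric.infDist x K / δ) := by
  have hd : Metric.infEDist x K = ENNReal.ofReal (Metric.infDist x K) :=
    (ENNReal.ofReal_toReal (Metric.infEDist_ne_top hK)).symm
  rw [thickenedIndicator.coeFn_eq_comp]
  simp only [Function.comp_apply, thickenedIndicatorAux]
  rw [ENNReal.coe_toNNReal_eq_toReal, hd, ← ENNReal.ofReal_div_of_pos hδ, ← ENNReal.ofReal_one,
    ← ENNReal.ofReal_sub _ (div_nonneg Metric.infDist_nonneg hδ.le),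
    ENNReal.toReal_ofReal', max_comm]

/-- The same combination of the points of `K` and `L` nearest to `x` and `y` is a competitor for the
distance on the left. -/
theorem infDist_smul_add_smul_le {X : Type*} [NormedAddCommGroup X] [NormedSpace ℝ X]
    {K L : Set X} (hK : IsCompact K) (hL : IsCompact L) (hK' : K.Nonempty) (hL' : L.Nonempty)
    {θ : ℝ} (h0 : 0 < θ) (h1 : θ < 1) (x y : X) :
    Metric.infDist (θ • x + (1 - θ) • y) (θ • K + (1 - θ) • L) ≤
      θ * Metric.infDist x K + (1 - θ) * Metric.infDist y L := by
  obtain ⟨a, ha, hxa⟩ := hK.exists_infDist_eq_dist hK' x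
  obtain ⟨b, hb, hyb⟩ := hL.exists_infDist_eq_dist hL' y
  refine (Metric.infDist_le_dist_of_mem
    (Set.add_mem_add (Set.smul_mem_smul_set ha) (Set.smul_mem_smul_set hb))).trans ?_
  refine (dist_add_add_le _ _ _ _).trans ?_
  rw [dist_smul₀, dist_smul₀, Real.norm_of_nonneg h0.le, Real.norm_of_nonneg (sub_pos.2 h1).le,
    hxa, hyb]

/-- The inequality is applied to the tents `max 0 (1 - infDist x S / δ)`, whose integrals tend to
the measure of the closed set `S` as `δ → 0`. -/
theorem IsPrekopaLeindler.measureReal_le {X : Type*} [NormedAddCommGroup X] [NormedSpace ℝ X]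
    [MeasurableSpace X] [BorelSpace X] {μ : Measure X} [IsFiniteMeasure μ]
    (hμ : IsPrekopaLeindler μ) {K L : Set X} (hK : IsCompact K) (hL : IsCompact L)
    {θ : ℝ} (h0 : 0 < θ) (h1 : θ < 1) :
    μ.real K ^ θ * μ.real L ^ (1 - θ) ≤ μ.real (θ • K + (1 - θ) • L) := by
  have h1' : 0 < 1 - θ := sub_pos.2 h1
  rcases K.eq_empty_or_nonempty with rfl | hK'
  · simp [Real.zero_rpow h0.ne']
  rcases L.eq_empty_or_nonempty with rfl | hL'
  · simp [Real.zero_rpow h1'.ne']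
  have hδ : ∀ n : ℕ, 0 < 1 / ((n : ℝ) + 1) := fun n => Nat.one_div_pos_of_nat
  have hC : IsCompact (θ • K + (1 - θ) • L) := (hK.smul θ).add (hL.smul (1 - θ))
  have hC' : (θ • K + (1 - θ) • L).Nonempty := hK'.smul_set.add hL'.smul_set
  have hlim := fun {S : Set X} (hS : IsClosed S) => tendsto_integral_thickenedIndicator_of_isClosed
    μ hS hδ tendsto_one_div_add_atTop_nhds_zero_nat
  refine le_of_tendsto_of_tendsto' (((hlim hK.isClosed).rpow_const (Or.inr h0.le)).mul
    ((hlim hL.isClosed).rpow_const (Or.inr h1'.le))) (hlim hC.isClosed) fun n => ?_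
  let ind : Set X → BoundedContinuousFunction X ℝ := fun S =>
    BoundedContinuousFunction.ofNormedAddCommGroup
      (fun x => (thickenedIndicator (hδ n) S x : ℝ)) (by fun_prop) 1 fun x => by
        simpa using thickenedIndicator_le_one (hδ n) S x
  refine hμ θ h0 h1 (ind K) (ind L) (ind _) (fun x => NNReal.coe_nonneg _)
    (fun x => NNReal.coe_nonneg _) (fun x => NNReal.coe_nonneg _) fun x y => ?_
  have hind : ∀ S : Set X, S.Nonempty → ∀ x, ind S x =
      max 0 (1 - Metric.infDist x S / (1 / ((n : ℝ) + 1))) := fun S hS x =>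
    coe_thickenedIndicator_eq_max (hδ n) hS x
  rw [hind K hK', hind L hL', hind _ hC']
  set δ := 1 / ((n : ℝ) + 1) with hδdef
  have hd := infDist_smul_add_smul_le hK hL hK' hL' h0 h1 x y
  rcases le_or_gt (1 - Metric.infDist x K / δ) 0 with hx | hx
  · simp [max_eq_left hx, Real.zero_rpow h0.ne']
  rcases le_or_gt (1 - Metric.infDist y L / δ) 0 with hy | hy
  · simp [max_eq_left hy, Real.zero_rpow h1'.ne']
  rw [max_eq_right hx.le, max_eq_right hy.le]
  -- When both tents are positive, their geometric mean is at most the arithmetic mean, which the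
  -- distance bound `hd` compares with the tent of the Minkowski sum.
  refine (Real.geom_mean_le_arith_mean2_weighted h0.le h1'.le hx.le hy.le (by ring)).trans
    (le_max_of_le_right ?_)
  have := div_le_div_of_nonneg_right hd (hδ n).le
  rw [add_div, mul_div_assoc, mul_div_assoc, ← hδdef] at this
  linarith

/-- Inner regularity reduces to compact subsets of `A` and `B`. Only monotonicity is used for the
full Minkowski sum, which need not be Borel. -/
theorem IsPrekopaLeindler.isLogConcave {n : ℕ} {μ : Measure (Fin n → ℝ)} [IsFiniteMeasure μ]
    (hμ : IsPrekopaLeindler μ) : IsLogConcave μ := by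
  intro A B hA hB θ h0 h1
  have h1' : 0 < 1 - θ := sub_pos.2 h1
  refine ENNReal.mul_le_of_forall_lt fun a ha b hb => ?_
  have hex : ∀ S : Set (Fin n → ℝ), MeasurableSet S → ∀ r : ℝ, 0 < r → ∀ c < μ S ^ r,
      ∃ K ⊆ S, IsCompact K ∧ c ≤ μ K ^ r := by
    intro S hS r hr c hc
    obtain ⟨K, hKS, hK, hlt⟩ := hS.exists_lt_isCompact
      ((ENNReal.lt_rpow_inv_iff (inv_pos.2 hr)).1 (by simpa using hc) : c ^ r⁻¹ < μ S)
    exact ⟨K, hKS, hK, ((ENNReal.rpow_inv_lt_iff hr).1 hlt).le⟩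
  obtain ⟨K, hKA, hK, haK⟩ := hex A hA θ h0 a ha
  obtain ⟨L, hLB, hL, hbL⟩ := hex B hB (1 - θ) h1' b hb
  refine (mul_le_mul' haK hbL).trans (le_trans ?_ (measure_mono
    (Set.add_subset_add (Set.smul_set_mono hKA) (Set.smul_set_mono hLB))))
  have := hμ.measureReal_le hK hL h0 h1
  rw [← ofReal_measureReal (s := K), ← ofReal_measureReal (s := L), ← ofReal_measureReal,
    ENNReal.ofReal_rpow_of_nonneg measureReal_nonneg h0.le,
    ENNReal.ofReal_rpow_of_nonneg measureReal_nonneg h1'.le,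
    ← ENNReal.ofReal_mul (Real.rpow_nonneg measureReal_nonneg _)]
  exact ENNReal.ofReal_le_ofReal this

end

section

/-! ### Laws of random continuous functions on a compact metric space -/

variable {X : Type*} [MetricSpace X] [CompactSpace X]

/-- Finite rank approximation of the identity of `C(X, ℝ)`, through a partition of unity. -/
theorem exists_finset_linearMap_approx {ε : ℝ} (hε : 0 < ε) :
    ∃ (s : Finset X) (T : (s → ℝ) →ₗ[ℝ] C(X, ℝ)), Continuous T ∧
      ∀ (z : C(X, ℝ)) (δ : ℝ), (∀ x y, dist x y < ε → |z x - z y| ≤ δ) →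
        ∀ y, |T (fun x => z x) y - z y| ≤ δ := by
  obtain ⟨t, -, ht, hcover⟩ := (isCompact_univ (X := X)).finite_cover_balls hε
  lift t to Finset X using ht
  let w : X → X → ℝ := fun x y => max 0 (ε - dist x y)
  have hw0 : ∀ x y, 0 ≤ w x y := fun x y => le_max_left _ _
  have hS : ∀ y, 0 < ∑ x : t, w x y := by
    intro y
    obtain ⟨x, hx, hxy⟩ := Set.mem_iUnion₂.1 (hcover (Set.mem_univ y))
    refine Finset.sum_pos' (fun x _ => hw0 x y) ⟨⟨x, hx⟩, Finset.mem_univ _, ?_⟩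
    refine lt_max_of_lt_right (sub_pos.2 ?_)
    rw [dist_comm]
    exact hxy
  have hwc : ∀ x, Continuous (w x) := fun x => by fun_prop
  let ρ : t → C(X, ℝ) := fun x => ⟨fun y => w x y / ∑ x : t, w x y,
    (hwc x).div (continuous_finsetSum _ fun x _ => hwc x) fun y => (hS y).ne'⟩
  have hρ : ∀ x y, ρ x y = w x y / ∑ x : t, w x y := fun _ _ => rfl
  have hρ0 : ∀ x y, 0 ≤ ρ x y := fun x y => div_nonneg (hw0 x y) (hS y).le
  have hρ1 : ∀ y, ∑ x, ρ x y = 1 := fun y => by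
    simp_rw [hρ, ← Finset.sum_div]
    exact div_self (hS y).ne'
  refine ⟨t, Fintype.linearCombination ℝ ρ, LinearMap.continuous_of_finiteDimensional _,
    fun z δ hz y => ?_⟩
  have h1 : Fintype.linearCombination ℝ ρ (fun x : t => z x) y = ∑ x : t, z x * ρ x y := by
    simp [Fintype.linearCombination_apply, ContinuousMap.sum_apply]
  have h2 : z y = ∑ x : t, z y * ρ x y := by rw [← Finset.mul_sum, hρ1, mul_one]
  rw [h1, h2, ← Finset.sum_sub_distrib]
  calc |∑ x : t, (z x * ρ x y - z y * ρ x y)| ≤ ∑ x : t, |z x * ρ x y - z y * ρ x y| :=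
        Finset.abs_sum_le_sum_abs _ _
    -- Only centres within `ε` of `y` carry weight at `y`, and at each of those `z` differs from `z
    -- y` by at most `δ`.
    _ ≤ ∑ x : t, δ * ρ x y := by
        refine Finset.sum_le_sum fun x _ => ?_
        rw [← sub_mul, abs_mul, abs_of_nonneg (hρ0 x y)]
        by_cases hxy : dist (x : X) y < ε
        · exact mul_le_mul_of_nonneg_right (hz _ _ hxy) (hρ0 x y)
        · have : ρ x y = 0 := by
            rw [hρ, show w x y = 0 from max_eq_left (by linarith), zero_div]
          simp [this]
    _ = δ := by rw [← Finset.mul_sum, hρ1, mul_one]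

/-- A law on `C(X, ℝ)` whose finite-dimensional marginals satisfy the Prékopa–Leindler inequality
satisfies it too. -/
theorem isPrekopaLeindler_of_marginals {γ : Measure C(X, ℝ)} [IsFiniteMeasure γ]
    (hγ : ∀ s : Finset X, IsPrekopaLeindler (γ.map fun (z : C(X, ℝ)) (x : s) => z x)) :
    IsPrekopaLeindler γ := by
  choose s T hT happrox using fun n : ℕ =>
    exists_finset_linearMap_approx (X := X) (Nat.one_div_pos_of_nat (n := n) (α := ℝ))
  have hev : ∀ n, Continuous fun (z : C(X, ℝ)) (x : s n) => z x := fun n => by fun_prop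
  have hPL : ∀ n, IsPrekopaLeindler (γ.map fun z => T n fun x => z x) := by
    intro n
    have := (hγ (s n)).map (hT n) fun θ x y => by simp
    rwa [Measure.map_map (hT n).measurable (hev n).measurable] at this
  -- By uniform continuity of each path `z`, its finite-rank approximations converge to `z`
  -- uniformly, so the image laws converge weakly to `γ`.
  refine IsPrekopaLeindler.of_tendsto (l := atTop) hPL fun f => ?_
  have hmap : ∀ n, ∫ z, f z ∂(γ.map fun z => T n fun x => z x) =
      ∫ z, f (T n fun x => z x) ∂γ := fun n =>
    integral_map ((hT n).comp (hev n)).measurable.aemeasurable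
      f.continuous.measurable.aestronglyMeasurable
  simp_rw [hmap]
  refine tendsto_integral_of_dominated_convergence (fun _ => ‖f‖)
    (fun n => (f.continuous.comp ((hT n).comp (hev n))).measurable.aestronglyMeasurable)
    (integrable_const _) (fun n => ae_of_all _ fun z => f.norm_coe_le_norm _)
    (ae_of_all _ fun z => (f.continuous.tendsto z).comp ?_)
  rw [Metric.tendsto_atTop]
  intro δ hδ
  obtain ⟨ε, hε, hz⟩ := Metric.uniformContinuous_iff.1
    (CompactSpace.uniformContinuous_of_continuous z.continuous) (δ / 2) (half_pos hδ)
  obtain ⟨N, hN⟩ := exists_nat_one_div_lt hε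
  refine ⟨N, fun n hn => ?_⟩
  refine ((ContinuousMap.dist_le (half_pos hδ).le).2 fun y => ?_).trans_lt (half_lt_self hδ)
  refine happrox n z (δ / 2) (fun x y hxy => (hz ?_).le) y
  exact hxy.trans ((Nat.one_div_le_one_div hn).trans_lt hN)

end

/-! ### Compactness and coordinates of the rectangle -/

namespace Box

variable (R : Box)

instance : CompactSpace ↥R.region :=
  isCompact_iff_compactSpace.1 (isCompact_Icc.prod isCompact_Icc)

/-- The layer of a point of the rectangle. -/
def layer (p : ↥R.region) : R.Layer := ⟨p.1.1, p.2.1⟩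

/-- The time of a point of the rectangle. -/
def time (p : ↥R.region) : R.Time := ⟨p.1.2, p.2.2⟩

theorem continuous_pt (j : R.Layer) : Continuous (R.pt j) := by
  unfold Box.pt
  fun_prop

instance : IsFiniteMeasure R.timeMeasure := by
  constructor
  rw [timeMeasure, comap_subtype_coe_apply measurableSet_Icc, Subtype.coe_image_univ]
  exact measure_Icc_lt_top

end Box

/-! ### Finite-dimensional marginals of shifted Brownian motions and bridges -/

/-- Finitely many values of independent Brownian motions are jointly Gaussian, and those of `Z` are
an affine image of them. The coefficient `c` lets one statement serve both motions (`c = 0`) and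
bridges. -/
theorem isGaussian_map_restrict {R : Box} {Ω : Type*} [MeasurableSpace Ω] {P : Measure Ω}
    {W : R.Layer → ℝ≥0 → Ω → ℝ} (hW : IsIndepBrownian W P) {Z : Ω → C(↥R.region, ℝ)}
    {γ : Measure C(↥R.region, ℝ)} (hZ : HasLaw Z γ P) (c d : R.Layer → R.Time → ℝ)
    (h : ∀ᵐ ω ∂P, ∀ (j : R.Layer) (t : R.Time), Z ω (R.pt j t) =
      W j (R.elapsed t) ω - c j t * W j (R.elapsed R.right) ω + d j t)
    (s : Finset ↥R.region) :
    IsGaussian (γ.map fun (z : C(↥R.region, ℝ)) (x : s) => z x) := by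
  classical
  -- The final time is included because the bridge subtracts a multiple of the endpoint value.
  let S : Finset ℝ≥0 := insert (R.elapsed R.right) (s.image fun x => R.elapsed (R.time x))
  have hU : HasGaussianLaw (fun ω (j : R.Layer) (i : S) => W j i ω) P :=
    iIndepFun.hasGaussianLaw
      (fun j => ((hW.isBrownian j).hasLaw S).hasGaussianLaw)
      (hW.indep.comp (fun _ path (i : S) => path i) fun _ => by fun_prop)
  let e : s → S := fun x => ⟨R.elapsed (R.time x),
    Finset.mem_insert_of_mem (Finset.mem_image_of_mem _ x.2)⟩
  let r : S := ⟨R.elapsed R.right, Finset.mem_insert_self _ _⟩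
  let A : (R.Layer → S → ℝ) →ₗ[ℝ] (s → ℝ) :=
    { toFun := fun u x => u (R.layer x) (e x) - c (R.layer x) (R.time x) * u (R.layer x) r
      map_add' := fun u v => by ext x; simp only [Pi.add_apply]; ring
      map_smul' := fun a u => by
        ext x
        simp only [Pi.smul_apply, smul_eq_mul, RingHom.id_apply]
        ring }
  have hA := (hU.map A.toContinuousLinearMap).isGaussian_map
  have hev : Continuous fun (z : C(↥R.region, ℝ)) (x : s) => z x := by fun_prop
  have hmap : γ.map (fun (z : C(↥R.region, ℝ)) (x : s) => z x) =
      (P.map (A.toContinuousLinearMap ∘ fun ω (j : R.Layer) (i : S) => W j i ω)).map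
        (fun v => v + fun x : s => d (R.layer x) (R.time x)) := by
    rw [← hZ.map_eq,
      AEMeasurable.map_map_of_aemeasurable hev.measurable.aemeasurable hZ.aemeasurable,
      AEMeasurable.map_map_of_aemeasurable (by fun_prop)
        (hU.map A.toContinuousLinearMap).aemeasurable]
    refine Measure.map_congr ?_
    filter_upwards [h] with ω hω
    ext x
    exact hω (R.layer x) (R.time x)
  rw [hmap]
  infer_instance

theorem isPrekopaLeindler_of_hasLaw {R : Box} {Ω : Type*} [MeasurableSpace Ω] {P : Measure Ω}
    {W : R.Layer → ℝ≥0 → Ω → ℝ} (hW : IsIndepBrownian W P) {Z : Ω → C(↥R.region, ℝ)}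
    {γ : Measure C(↥R.region, ℝ)} (hZ : HasLaw Z γ P) (c d : R.Layer → R.Time → ℝ)
    (h : ∀ᵐ ω ∂P, ∀ (j : R.Layer) (t : R.Time), Z ω (R.pt j t) =
      W j (R.elapsed t) ω - c j t * W j (R.elapsed R.right) ω + d j t) :
    IsPrekopaLeindler γ := by
  -- At least one layer exists, and a Gaussian law for it, even at no times, forces `P` to have mass
  -- one.
  have := ((hW.isBrownian ⟨R.k, le_refl _, R.hkl⟩).hasLaw ∅).hasGaussianLaw.isProbabilityMeasure
  have := hZ.isProbabilityMeasure_iff.1 this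
  refine isPrekopaLeindler_of_marginals fun s => ?_
  have := isGaussian_map_restrict hW hZ c d h s
  exact (isMeasurablePrekopaLeindler_of_isGaussian _).isPrekopaLeindler

theorem IsShiftedWienerLaw.isPrekopaLeindler {R : Box} {x : R.Layer → ℝ} {η : C(↥R.region, ℝ)}
    {γ : Measure C(↥R.region, ℝ)} (hγ : IsShiftedWienerLaw R x η γ) : IsPrekopaLeindler γ := by
  obtain ⟨Ω, _, P, W, Z, hW, hZ, h⟩ := hγ
  exact isPrekopaLeindler_of_hasLaw hW hZ (fun _ _ => 0) (fun j t => x j + η (R.pt j t))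
    (h.mono fun ω hω j t => by rw [hω]; ring)

theorem IsShiftedBridgeLaw.isPrekopaLeindler {R : Box} {x y : R.Layer → ℝ} {η : C(↥R.region, ℝ)}
    {γ : Measure C(↥R.region, ℝ)} (hγ : IsShiftedBridgeLaw R x y η γ) : IsPrekopaLeindler γ := by
  obtain ⟨Ω, _, P, W, Z, hW, hZ, h⟩ := hγ
  exact isPrekopaLeindler_of_hasLaw hW hZ (fun _ t => ((t : ℝ) - R.a) / (R.b - R.a))
    (fun j t => ((R.b - (t : ℝ)) * x j + ((t : ℝ) - R.a) * y j) / (R.b - R.a) + η (R.pt j t))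
    (h.mono fun ω hω j t => by rw [hω]; ring)

/-! ### Convex Hamiltonians -/

namespace Hamiltonian

variable {R : Box} (H : Hamiltonian R)

theorem continuous_uncurry_slice :
    Continuous fun q : C(↥R.region, ℝ) × R.Time => R.slice q.1 q.2 :=
  continuous_pi fun j => continuous_eval.comp
    (continuous_fst.prodMk ((R.continuous_pt j).comp continuous_snd))

theorem continuous_slice (t : R.Time) : Continuous fun z => R.slice z t :=
  continuous_uncurry_slice.comp (Continuous.prodMk_left t)

theorem continuous_uncurry_F_slice :
    Continuous fun q : C(↥R.region, ℝ) × R.Time => H.F q.2 (R.slice q.1 q.2) :=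
  H.continuous_F.comp (continuous_snd.prodMk continuous_uncurry_slice)

theorem integrable_F_slice (z : C(↥R.region, ℝ)) :
    Integrable (fun t => H.F t (R.slice z t)) R.timeMeasure :=
  (H.continuous_uncurry_F_slice.comp (Continuous.prodMk_right z)).integrable_of_hasCompactSupport
    (HasCompactSupport.of_compactSpace _)

/-- Each `f i` is continuous, being convex on a finite-dimensional space. The integral term is the
map `z ↦ F(·, z(·))` into `C([a, b], ℝ)`, followed by integration, which is Lipschitz for the sup
norm. -/
theorem continuous_eval : Continuous H.eval := by
  refine (continuous_finsetSum _ fun i _ => ?_).add ?_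
  · exact (continuousOn_univ.1 ((H.convex_f i).continuousOn isOpen_univ)).comp
      (continuous_slice (H.τ i))
  · let G : C(↥R.region, ℝ) → C(R.Time, ℝ) := fun z =>
      ⟨fun t => H.F t (R.slice z t), H.continuous_uncurry_F_slice.comp (Continuous.prodMk_right z)⟩
    have hG : Continuous G :=
      ContinuousMap.continuous_of_continuous_uncurry _ H.continuous_uncurry_F_slice
    have hI : Continuous fun g : C(R.Time, ℝ) => ∫ t, g t ∂(R.timeMeasure) := by
      refine (LipschitzWith.of_dist_le_mul (K := (R.timeMeasure.real Set.univ).toNNReal)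
        fun g g' => ?_).continuous
      rw [Real.coe_toNNReal _ measureReal_nonneg, dist_eq_norm, ← integral_sub, mul_comm]
      · exact norm_integral_le_of_norm_le_const (ae_of_all _ fun t => by
          rw [← dist_eq_norm]; exact ContinuousMap.dist_apply_le_dist t)
      · exact g.continuous.integrable_of_hasCompactSupport (HasCompactSupport.of_compactSpace _)
      · exact g'.continuous.integrable_of_hasCompactSupport (HasCompactSupport.of_compactSpace _)
    exact hI.comp hG

theorem convexOn_eval : ConvexOn ℝ Set.univ H.eval := by
  have hslice : ∀ (a b : ℝ) (z z' : C(↥R.region, ℝ)) (t : R.Time),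
      R.slice (a • z + b • z') t = a • R.slice z t + b • R.slice z' t := fun _ _ _ _ _ => rfl
  refine ⟨convex_univ, fun z _ z' _ a b ha hb hab => ?_⟩
  have h1 : ∑ i, H.f i (R.slice (a • z + b • z') (H.τ i)) ≤
      a * ∑ i, H.f i (R.slice z (H.τ i)) + b * ∑ i, H.f i (R.slice z' (H.τ i)) := by
    rw [Finset.mul_sum, Finset.mul_sum, ← Finset.sum_add_distrib]
    refine Finset.sum_le_sum fun i _ => ?_
    rw [hslice]
    exact (H.convex_f i).2 (Set.mem_univ _) (Set.mem_univ _) ha hb hab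
  have h2 : ∫ t, H.F t (R.slice (a • z + b • z') t) ∂(R.timeMeasure) ≤
      a * ∫ t, H.F t (R.slice z t) ∂(R.timeMeasure) +
        b * ∫ t, H.F t (R.slice z' t) ∂(R.timeMeasure) := by
    rw [← integral_const_mul, ← integral_const_mul, ← integral_add
      ((H.integrable_F_slice z).const_mul a) ((H.integrable_F_slice z').const_mul b)]
    refine integral_mono (H.integrable_F_slice _) (((H.integrable_F_slice z).const_mul a).add
      ((H.integrable_F_slice z').const_mul b)) fun t => ?_
    simp only [hslice]
    exact (H.convex_F t).2 (Set.mem_univ _) (Set.mem_univ _) ha hb hab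
  simp only [eval, smul_eq_mul]
  linarith

end Hamiltonian

/-! ### Perturbations and their local weak limits -/

theorem IsPrekopaLeindler.tilted_hamiltonian {R : Box} {γ : Measure C(↥R.region, ℝ)}
    (hγ : IsPrekopaLeindler γ) (H : Hamiltonian R) {μ : ProbabilityMeasure C(↥R.region, ℝ)}
    (hμ : (μ : Measure C(↥R.region, ℝ)) = γ.tilted fun z => -H.eval z) :
    IsPrekopaLeindler (μ : Measure C(↥R.region, ℝ)) := by
  have hint : Integrable (fun z => Real.exp (-H.eval z)) γ := by
    -- Without integrability the tilt is the zero measure by convention, which is not a probability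
    -- measure.
    by_contra hcon
    rw [tilted_of_not_integrable hcon] at hμ
    exact IsProbabilityMeasure.ne_zero _ hμ
  rw [hμ]
  exact hγ.tilted H.continuous_eval H.convexOn_eval hint

theorem IsPerturbation.isPrekopaLeindler {R : Box} {μ : ProbabilityMeasure C(↥R.region, ℝ)}
    (h : IsPerturbation R μ) : IsPrekopaLeindler (μ : Measure C(↥R.region, ℝ)) := by
  cases h with
  | free x η hη γ hγ H hμ => exact hγ.isPrekopaLeindler.tilted_hamiltonian H hμ
  | bridge x y η hη hη' γ hγ H hμ => exact hγ.isPrekopaLeindler.tilted_hamiltonian H hμ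

theorem IsPrekopaLeindler.marginal {D K : Set (ℤ × ℝ)} {μ : ProbabilityMeasure C(↥D, ℝ)}
    (hμ : IsPrekopaLeindler (μ : Measure C(↥D, ℝ))) (h : K ⊆ D) :
    IsPrekopaLeindler (marginal μ h : Measure C(↥K, ℝ)) :=
  hμ.map (continuous_res h) fun _ _ _ => rfl

theorem TendstoLocallyWeakly.isPrekopaLeindler_marginal {D : ℕ → Set (ℤ × ℝ)} {D' : Set (ℤ × ℝ)}
    {μ : ∀ i, ProbabilityMeasure C(↥(D i), ℝ)} {ν : ProbabilityMeasure C(↥D', ℝ)}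
    (h : TendstoLocallyWeakly μ ν)
    (hμ : ∀ i, IsPrekopaLeindler (μ i : Measure C(↥(D i), ℝ)))
    {K : Set (ℤ × ℝ)} (hK : K ⊆ D') (hKc : IsCompact K) :
    IsPrekopaLeindler (LineEnsemble.marginal ν hK : Measure C(↥K, ℝ)) := by
  obtain ⟨N, hN, hlim⟩ := h.tendsto K hK hKc
  exact IsPrekopaLeindler.of_tendsto (l := atTop) (fun i => (hμ (N + i)).marginal (hN i))
    (ProbabilityMeasure.tendsto_iff_forall_integral_tendsto.1 hlim)

/-- The finite set of evaluation points is itself a compact `K`, so weak convergence on that set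
suffices. -/
theorem TendstoLocallyWeakly.isLogConcave_map_eval {D : ℕ → Set (ℤ × ℝ)} {D' : Set (ℤ × ℝ)}
    {μ : ∀ i, ProbabilityMeasure C(↥(D i), ℝ)} {ν : ProbabilityMeasure C(↥D', ℝ)}
    (h : TendstoLocallyWeakly μ ν)
    (hμ : ∀ i, IsPrekopaLeindler (μ i : Measure C(↥(D i), ℝ))) {n : ℕ} (p : Fin n → ↥D') :
    IsLogConcave ((ν : Measure C(↥D', ℝ)).map fun z i => z (p i)) := by
  set K : Set (ℤ × ℝ) := Set.range fun i => (p i : ℤ × ℝ) with hKdef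
  have hK : K ⊆ D' := Set.range_subset_iff.2 fun i => (p i).2
  have hPL := (h.isPrekopaLeindler_marginal hμ hK (Set.finite_range _).isCompact).map
    (T := fun z i => z ⟨p i, Set.mem_range_self i⟩) (by fun_prop) fun _ _ _ => rfl
  have hmap : (LineEnsemble.marginal ν hK : Measure C(↥K, ℝ)).map
      (fun z i => z ⟨p i, Set.mem_range_self i⟩) =
      (ν : Measure C(↥D', ℝ)).map fun z i => z (p i) := by
    rw [LineEnsemble.marginal, ProbabilityMeasure.toMeasure_map, Measure.map_map
      (Continuous.measurable (by fun_prop)) (continuous_res hK).measurable]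
    rfl
  rw [hmap] at hPL
  exact hPL.isLogConcave

end LineEnsemble

theorem mainTheorem4 {Λ : Set ℤ} {I : Set ℝ} (hΛ : Λ.OrdConnected) (hI : I.OrdConnected)
    {Ω : Type*} [MeasurableSpace Ω] (P : Measure Ω) [IsProbabilityMeasure P]
    (L : Ω → C(↥(Λ ×ˢ I), ℝ)) (hL : LineEnsemble.InLC P L)
    (n : ℕ) (p : Fin n → ↥(Λ ×ˢ I)) :
    LineEnsemble.IsLogConcave (P.map (fun ω i => L ω (p i))) := by
  obtain ⟨ν, hν, R, μ, hμ, hlim⟩ := hL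
  have := hlim.isLogConcave_map_eval (fun i => (hμ i).isPrekopaLeindler) p
  rwa [← hν.map_eq, AEMeasurable.map_map_of_aemeasurable
    (Continuous.measurable (by fun_prop)).aemeasurable hν.aemeasurable] at this
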